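/- Let $\kappa,\theta,\sigma,X_0>0$ and $T\ge 0$ be constants, let $W=(W(s))_{s\ge 0}$ be a standard real Brownian motion on a probability space, and let $(\mathcal F_s)_{s\ge0}$ be its natural filtration. Let $0=t_0<t_1<\dots<t_N=T$ be a possibly random mesh, where $N<\infty$ almost surely; put $t_n:=T$ for $n>N$. Write $\Delta t_{n+1}:=t_{n+1}-t_n$ and $\Delta W_{n+1}:=W(t_{n+1})-W(t_n)$. Assume that every $t_n$ is an $(\mathcal F_s)$-stopping time, that $\Delta t_{n+1}$ is $\mathcal F_{t_n}$-measurable for every $n\ge 0$, and that there is a deterministic constant $\Delta t_{\max}$ with $\Delta t_n\le\Delta t_{\max}$ almost surely for $1\le n\le N$. Let $\alpha:=(4\kappa\theta-\sigma^2)/8$, and let $(X_n)$ be the splitting scheme for the Cox–Ingersoll–Ross equation $dX(t)=\kappa(\theta-X(t))\,dt+\sigma\sqrt{X(t)}\,dW(t)$, $X(0)=X_0$, that is $$X_{n+1}=e^{-\kappa\Delta t_{n+1}}\Big(X_n+2\alpha\Delta t_{n+1}+\sigma\sqrt{X_n+2\alpha\Delta t_{n+1}}\,\Delta W_{n+1}+\tfrac{\sigma^2}{4}(\Delta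 W_{n+1})^2\Big),\qquad 0\le n<N.$$ If $\alpha<0$, assume in addition that the square root is real, i.e. that almost surely $X_n+2\alpha\Delta t_{n+1}\ge 0$ for all $0\le n<N$ (for $\alpha\ge0$ this is automatic). For $t\in(0,T]$ let $N^{(t)}:=\max\{n\ge 1: t_{n-1}<t\}$, the index of the right endpoint of the step that contains $t$, and let $N^{(0)}:=0$. Then for every $t\in[0,T]$ the random variable $X_{N^{(t)}}$ is integrable and $$\mathbb E\big[X_{N^{(t)}}\big]\le X_0+\kappa\theta T .$$ -/

import Mathlib

open MeasureTheory ProbabilityTheory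
open scoped NNReal

namespace CIRSplitting

/-- The coefficient `α = (4κθ - σ²)/8` of the Lamperti transformed equation. -/
noncomputable def alpha (κ θ σ : ℝ) : ℝ := (4 * κ * θ - σ ^ 2) / 8

variable {Ω : Type*}

/-- The step `Δt_{n+1} = t_{n+1} - t_n` of the (possibly random) mesh `t`. -/
def dt (t : ℕ → Ω → ℝ≥0) (n : ℕ) (ω : Ω) : ℝ := (t (n + 1) ω : ℝ) - (t n ω : ℝ)

/-- The increment `ΔW_{n+1} = W(t_{n+1}) - W(t_n)` of `W` over the (possibly random) step. -/
def dW (W : ℝ≥0 → Ω → ℝ) (t : ℕ → Ω → ℝ≥0) (n : ℕ) (ω : Ω) : ℝ :=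
  W (t (n + 1) ω) ω - W (t n ω) ω

/-- The splitting scheme for the CIR process with initial value `X₀`, driven by `W`,
on the mesh `t`. -/
noncomputable def scheme (κ θ σ X₀ : ℝ) (W : ℝ≥0 → Ω → ℝ) (t : ℕ → Ω → ℝ≥0) : ℕ → Ω → ℝ
  | 0, _ => X₀
  | n + 1, ω =>
    Real.exp (-κ * dt t n ω) *
      (scheme κ θ σ X₀ W t n ω + 2 * alpha κ θ σ * dt t n ω
        + σ * √(scheme κ θ σ X₀ W t n ω + 2 * alpha κ θ σ * dt t n ω) * dW W t n ω
        + σ ^ 2 * (dW W t n ω) ^ 2 / 4)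

/-- The set of all `n ≥ 1` with `t_{n-1} < s`. -/
def stepSet (t : ℕ → Ω → ℝ≥0) (s : ℝ≥0) (ω : Ω) : Set ℕ := {n | 1 ≤ n ∧ t (n - 1) ω < s}

/-- `N^{(s)} = max {n ≥ 1 : t_{n-1} < s}`, the index of the right endpoint of the step that
contains `s`. The set is empty for `s = 0`, and then `N^{(0)} = 0`. -/
noncomputable def stepIndex (t : ℕ → Ω → ℝ≥0) (s : ℝ≥0) (ω : Ω) : ℕ := sSup (stepSet t s ω)

/-- The possibly random meshes `0 = t_0 < t_1 < ⋯ < t_N = T`, where `N = N^{(T)}` is finite almost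
surely. The mesh is a sequence that stays at `T` once it has reached `T`. Every node is a
stopping time of the natural filtration `(ℱ_s)` of `W`, the step `Δt_{n+1}` is
`ℱ_{t_n}`-measurable, and the steps are bounded by the deterministic constant `dtMax`. -/
structure IsAdmissibleMesh [MeasurableSpace Ω] (P : Measure Ω) (W : ℝ≥0 → Ω → ℝ)
    (hW : ∀ s, Measurable (W s)) (T dtMax : ℝ≥0) (t : ℕ → Ω → ℝ≥0) : Prop where
  isStoppingTime : ∀ n, IsStoppingTime (Filtration.natural W fun s => (hW s).stronglyMeasurable)
    (fun ω => (t n ω : WithTop ℝ≥0))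
  measurable_dt : ∀ n, Measurable[(isStoppingTime n).measurableSpace] (dt t n)
  zero : ∀ᵐ ω ∂P, t 0 ω = 0
  le_end : ∀ᵐ ω ∂P, ∀ n, t n ω ≤ T
  lt_succ : ∀ᵐ ω ∂P, ∀ n, t n ω < T → t n ω < t (n + 1) ω
  eq_end : ∀ᵐ ω ∂P, ∀ n, t n ω = T → t (n + 1) ω = T
  finite : ∀ᵐ ω ∂P, (stepSet t T ω).Finite
  dt_le : ∀ᵐ ω ∂P, ∀ n, n < stepIndex t T ω → dt t n ω ≤ dtMax

end CIRSplitting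

open Filter Topology
open scoped ENNReal BoundedContinuousFunction

namespace CIRSplitting

/-! Freeze the current value `x`, the step size `d` and a Gaussian increment of variance `d`. Then
one step has mean exactly `e^{-κd}(x + κθd)`, because `2α + σ²/4 = κθ`; this is at most `x + κθd`
(`lintegral_schemeStep_gaussian`). The bracket in the step is a perfect square, so the scheme stays
nonnegative.

Freezing is legitimate although nodes and steps are random: the strong Markov property
`map_prodMk_increment` replaces `ΔW` by `√Δt Z`, with `Z` standard Gaussian and independent of
`ℱ_{t_n}`. It is proved by discretizing the stopping time and the step length on a grid.

Stop the scheme once a node has reached `s`. Summing the one-step bounds telescopes the step lengths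
to `t_n ≤ T` (`lintegral_stoppedScheme_le`). The number of steps is almost surely finite but need
not be bounded, so Fatou's lemma gives the passage `n → ∞`. -/

/-! ### Discretization of nonnegative reals -/

/-- The index of the cell of the grid of mesh `1 / (k + 1)` that contains `x`. -/
@[irreducible] noncomputable def gridIndex (k : ℕ) (x : ℝ≥0) : ℕ := ⌊((k : ℝ≥0) + 1) * x⌋₊

/-- The `j`-th point of the grid of mesh `1 / (k + 1)`. -/
@[irreducible] noncomputable def gridPoint (k j : ℕ) : ℝ≥0 := j / ((k : ℝ≥0) + 1)

lemma measurable_gridIndex (k : ℕ) : Measurable (gridIndex k) := by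
  unfold gridIndex
  exact Nat.measurable_floor.comp (measurable_id.const_mul _)

lemma gridPoint_gridIndex_le (k : ℕ) (x : ℝ≥0) : gridPoint k (gridIndex k x) ≤ x := by
  have h : (0 : ℝ≥0) < (k : ℝ≥0) + 1 := by positivity
  rw [gridPoint, gridIndex, div_le_iff₀ h, mul_comm]
  exact Nat.floor_le (by positivity)

lemma lt_gridPoint_gridIndex_add_one (k : ℕ) (x : ℝ≥0) :
    x < gridPoint k (gridIndex k x + 1) := by
  have h : (0 : ℝ≥0) < (k : ℝ≥0) + 1 := by positivity
  rw [gridPoint, gridIndex, lt_div_iff₀ h, mul_comm]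
  push_cast
  exact Nat.lt_floor_add_one _

lemma gridPoint_add_one (k j : ℕ) : gridPoint k (j + 1) = gridPoint k j + 1 / ((k : ℝ≥0) + 1) := by
  simp [gridPoint, add_div]

lemma tendsto_gridPoint_gridIndex (x : ℝ≥0) :
    Tendsto (fun k => gridPoint k (gridIndex k x)) atTop (𝓝 x) := by
  have h1 : Tendsto (fun k : ℕ => x - 1 / ((k : ℝ≥0) + 1)) atTop (𝓝 (x - 0)) :=
    (tendsto_const_nhds).sub tendsto_one_div_add_atTop_nhds_zero_nat
  rw [tsub_zero] at h1
  refine tendsto_of_tendsto_of_tendsto_of_le_of_le h1 tendsto_const_nhds (fun k => ?_)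
    fun k => gridPoint_gridIndex_le k x
  have := (lt_gridPoint_gridIndex_add_one k x).le
  rw [gridPoint_add_one] at this
  exact tsub_le_iff_right.2 this

lemma tendsto_gridPoint_gridIndex_add_one (x : ℝ≥0) :
    Tendsto (fun k => gridPoint k (gridIndex k x + 1)) atTop (𝓝 x) := by
  simp_rw [gridPoint_add_one]
  simpa using (tendsto_gridPoint_gridIndex x).add
    (tendsto_one_div_add_atTop_nhds_zero_nat (𝕜 := ℝ≥0))

/-! ### Stopping times of a filtration indexed by the nonnegative reals -/

section StoppingTime

variable {Ω : Type*} {mΩ : MeasurableSpace Ω} {ℱ : Filtration ℝ≥0 mΩ} {τ : Ω → ℝ≥0}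

lemma measurable_of_isStoppingTime (hτ : IsStoppingTime ℱ (fun ω => (τ ω : WithTop ℝ≥0))) :
    Measurable[hτ.measurableSpace] τ := by
  refine measurable_of_Iic fun i => ?_
  change MeasurableSet[hτ.measurableSpace] {ω | τ ω ≤ i}
  simpa only [WithTop.coe_le_coe] using hτ.measurableSet_le' i

lemma measurableSet_of_subset_le (hτ : IsStoppingTime ℱ (fun ω => (τ ω : WithTop ℝ≥0)))
    {S : Set Ω} (hS : MeasurableSet[hτ.measurableSpace] S) {q : ℝ≥0} (h : ∀ ω ∈ S, τ ω ≤ q) :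
    MeasurableSet[ℱ q] S := by
  have := hS.2 q
  rwa [Set.inter_eq_left.2] at this
  intro ω hω
  exact WithTop.coe_le_coe.2 (h ω hω)

/-- An event known at time `q` is known at `τ` wherever `q ≤ τ`. This serves rounding `τ` down; the
preceding lemma serves rounding `τ` up. -/
lemma measurableSet_stoppingTime_of_subset_ge
    (hτ : IsStoppingTime ℱ (fun ω => (τ ω : WithTop ℝ≥0)))
    {S : Set Ω} {q : ℝ≥0} (hS : MeasurableSet[ℱ q] S) (h : ∀ ω ∈ S, q ≤ τ ω) :
    MeasurableSet[hτ.measurableSpace] S := by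
  refine ⟨le_iSup ℱ q _ hS, fun i => ?_⟩
  by_cases hqi : q ≤ i
  · exact (ℱ.mono hqi _ hS).inter (hτ i)
  · convert @MeasurableSet.empty _ (ℱ i)
    ext ω
    simp only [Set.mem_inter_iff, Set.mem_ofPred_eq, Set.mem_empty_iff_false, iff_false, not_and]
    intro hω hi
    exact hqi ((h ω hω).trans (WithTop.coe_le_coe.1 hi))

/-- Rounding `τ` down only looks into the past: on each cell the process is read at a fixed time not
exceeding `τ`. -/
lemma measurable_gridPoint_eval (hτ : IsStoppingTime ℱ (fun ω => (τ ω : WithTop ℝ≥0)))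
    {u : ℝ≥0 → Ω → ℝ} (hu : ∀ i, Measurable[ℱ i] (u i)) (k : ℕ) :
    Measurable[hτ.measurableSpace] (fun ω => u (gridPoint k (gridIndex k (τ ω))) ω) := by
  intro B hB
  have hidx : Measurable[hτ.measurableSpace] (fun ω => gridIndex k (τ ω)) :=
    (measurable_gridIndex k).comp (measurable_of_isStoppingTime hτ)
  have : (fun ω => u (gridPoint k (gridIndex k (τ ω))) ω) ⁻¹' B =
      ⋃ j : ℕ, (u (gridPoint k j) ⁻¹' B ∩ {ω | gridPoint k j ≤ τ ω}) ∩
        {ω | gridIndex k (τ ω) = j} := by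
    ext ω
    simp only [Set.mem_preimage, Set.mem_iUnion, Set.mem_inter_iff, Set.mem_ofPred_eq]
    constructor
    · exact fun h => ⟨_, ⟨h, gridPoint_gridIndex_le _ _⟩, rfl⟩
    · rintro ⟨j, ⟨h, -⟩, rfl⟩
      exact h
  rw [this]
  refine MeasurableSet.iUnion fun j => MeasurableSet.inter ?_ (hidx (measurableSet_singleton j))
  refine measurableSet_stoppingTime_of_subset_ge hτ (q := gridPoint k j) ?_ fun ω hω => hω.2
  refine (hu _ hB).inter ?_
  simpa only [WithTop.coe_le_coe] using hτ.measurableSet_ge (gridPoint k j)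

/-- A process that is adapted and almost surely continuous is, at a stopping time `τ`,
almost everywhere equal to an `ℱ_τ`-measurable function. -/
lemma aestronglyMeasurable_eval_stoppingTime {P : Measure Ω}
    (hτ : IsStoppingTime ℱ (fun ω => (τ ω : WithTop ℝ≥0)))
    {u : ℝ≥0 → Ω → ℝ} (hu : ∀ i, Measurable[ℱ i] (u i)) (hc : ∀ᵐ ω ∂P, Continuous (u · ω)) :
    AEStronglyMeasurable[hτ.measurableSpace] (fun ω => u (τ ω) ω) P := by
  -- The `limsup` is measurable even on the null set where the path is discontinuous and the limit
  -- may not exist.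
  refine ⟨fun ω => limsup (fun k => u (gridPoint k (gridIndex k (τ ω))) ω) atTop,
    (Measurable.limsup fun k => measurable_gridPoint_eval hτ hu k).stronglyMeasurable, ?_⟩
  filter_upwards [hc] with ω hω
  exact ((hω.tendsto (τ ω)).comp (tendsto_gridPoint_gridIndex (τ ω))).limsup_eq.symm

/-- As `τ ≤ π` holds only almost surely and `ℱ` need not contain the null sets, `ℱ_τ ⊆ ℱ_π` can
fail. Cutting off outside `{τ ≤ π}`, an event of `ℱ_π`, repairs this. -/
lemma aestronglyMeasurable_mono_stoppingTime {P : Measure Ω} {π : Ω → ℝ≥0}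
    (hτ : IsStoppingTime ℱ (fun ω => (τ ω : WithTop ℝ≥0)))
    (hπ : IsStoppingTime ℱ (fun ω => (π ω : WithTop ℝ≥0))) (h : ∀ᵐ ω ∂P, τ ω ≤ π ω)
    {f : Ω → ℝ} (hf : AEStronglyMeasurable[hτ.measurableSpace] f P) :
    AEStronglyMeasurable[hπ.measurableSpace] f P := by
  obtain ⟨g, hg, hfg⟩ := hf
  refine ⟨{ω | τ ω ≤ π ω}.indicator g, ?_, ?_⟩
  · refine Measurable.stronglyMeasurable fun B hB => ?_
    rw [Set.indicator_preimage]
    have hle : ∀ S, MeasurableSet[hτ.measurableSpace] S →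
        MeasurableSet[hπ.measurableSpace] (S ∩ {ω | τ ω ≤ π ω}) := fun S hS => by
      have := hτ.measurableSet_inter_le hπ S hS
      rw [hτ.measurableSet_min_iff hπ] at this
      simpa only [WithTop.coe_le_coe] using this.2
    have h2 : MeasurableSet[hπ.measurableSpace] {ω | τ ω ≤ π ω} := by
      simpa using hle Set.univ MeasurableSet.univ
    rw [Set.ite, Set.sdiff_eq]
    exact (hle _ (hg.measurable hB)).union ((measurable_const hB).inter h2.compl)
  · filter_upwards [hfg, h] with ω h1 h2
    rw [h1, Set.indicator_of_mem (by exact h2)]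

end StoppingTime

/-! ### Markov property at deterministic times -/

section Markov

variable {Ω : Type*} {mΩ : MeasurableSpace Ω} {P : Measure Ω} {W : ℝ≥0 → Ω → ℝ}

/-- The increment of a Brownian motion after a deterministic time is independent of the past. -/
lemma map_restrict_increment (hWm : ∀ s, Measurable (W s)) (hW : IsPreBrownianReal W P)
    (q d : ℝ≥0) {C : Set Ω}
    (hC : MeasurableSet[Filtration.natural W (fun s => (hWm s).stronglyMeasurable) q] C) :
    (P.restrict C).map (fun ω => W (q + d) ω - W q ω) = P C • gaussianReal 0 d := by
  have hlaw : P.map (fun ω => W (q + d) ω - W q ω) = gaussianReal 0 d :=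
    ((hW.shift q).hasLaw_eval d).map_eq
  have hYm : Measurable (fun ω => W (q + d) ω - W q ω) := (hWm _).sub (hWm _)
  rw [Filtration.natural_eq_comap] at hC
  obtain ⟨S, hS, rfl⟩ := hC
  ext B hB
  have hind := (hW.indepFun_shift q).comp (measurable_pi_apply d) measurable_id
  have := hind.measure_inter_preimage_eq_mul B S hB hS
  rw [Measure.map_apply hYm hB, Measure.restrict_apply (hYm hB), Measure.smul_apply, ← hlaw,
    Measure.map_apply hYm hB, smul_eq_mul, mul_comm]
  exact this

/-- Scaling one fixed Gaussian makes the dependence on the variance explicit, including `d = 0`. -/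
lemma gaussianReal_eq_map (d : ℝ≥0) :
    gaussianReal 0 d = (gaussianReal 0 1).map (fun z => √(d : ℝ) * z) := by
  rw [gaussianReal_map_const_mul]
  congr 1
  · simp
  · ext; simp [Real.sq_sqrt]

end Markov

/-! ### Strong Markov property for increments of random length -/

section StrongMarkov

variable {Ω : Type*} {mΩ : MeasurableSpace Ω} {P : Measure Ω} {W : ℝ≥0 → Ω → ℝ}
  {τ D : Ω → ℝ≥0}

/-- The increment of `W` over the approximation of `[τ, τ + D]` on the grid of mesh
`1 / (k + 1)`. -/
noncomputable def gridIncrement (W : ℝ≥0 → Ω → ℝ) (τ D : Ω → ℝ≥0) (k : ℕ) (ω : Ω) : ℝ :=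
  W (gridPoint k (gridIndex k (τ ω) + 1) + gridPoint k (gridIndex k (D ω))) ω -
    W (gridPoint k (gridIndex k (τ ω) + 1)) ω

lemma measurable_gridIncrement (hWm : ∀ s, Measurable (W s)) (hτ : Measurable τ)
    (hD : Measurable D) (k : ℕ) : Measurable (gridIncrement W τ D k) := by
  let F : (ℕ × ℕ) × Ω → ℝ := fun p =>
    W (gridPoint k (p.1.1 + 1) + gridPoint k p.1.2) p.2 - W (gridPoint k (p.1.1 + 1)) p.2
  have hF : Measurable F := measurable_from_prod_countable_right fun i =>
    Measurable.sub (hWm (gridPoint k (i.1 + 1) + gridPoint k i.2)) (hWm (gridPoint k (i.1 + 1)))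
  have hp : Measurable fun ω => ((gridIndex k (τ ω), gridIndex k (D ω)), ω) :=
    (((measurable_gridIndex k).comp hτ).prodMk
      ((measurable_gridIndex k).comp hD)).prodMk measurable_id
  exact hF.comp hp

lemma tendsto_gridIncrement {ω : Ω} (hω : Continuous (W · ω)) :
    Tendsto (fun k => gridIncrement W τ D k ω) atTop
      (𝓝 (W (τ ω + D ω) ω - W (τ ω) ω)) :=
  ((hω.tendsto _).comp ((tendsto_gridPoint_gridIndex_add_one (τ ω)).add
    (tendsto_gridPoint_gridIndex (D ω)))).sub
    ((hω.tendsto _).comp (tendsto_gridPoint_gridIndex_add_one (τ ω)))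

lemma aemeasurable_increment (hWm : ∀ s, Measurable (W s)) (hc : ∀ᵐ ω ∂P, Continuous (W · ω))
    (hτ : Measurable τ) (hD : Measurable D) :
    AEMeasurable (fun ω => W (τ ω + D ω) ω - W (τ ω) ω) P :=
  aemeasurable_of_tendsto_metrizable_ae atTop
    (fun k => (measurable_gridIncrement hWm hτ hD k).aemeasurable)
    (by filter_upwards [hc] with ω hω using tendsto_gridIncrement hω)

variable (hWm : ∀ s, Measurable (W s))
  (hτ : IsStoppingTime (Filtration.natural W fun s => (hWm s).stronglyMeasurable)
    (fun ω => (τ ω : WithTop ℝ≥0)))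

/-- On each of the countably many cells of `(τ, D)` the increment has deterministic endpoints. As
`τ` is rounded up to `q`, the cell's part of `S` lies in `ℱ_q`, so the Markov property at `q`
applies. -/
lemma setLIntegral_gridIncrement (hW : IsPreBrownianReal W P)
    (hD : Measurable[hτ.measurableSpace] D) {S : Set Ω} (hS : MeasurableSet[hτ.measurableSpace] S)
    {h : ℝ → ℝ≥0∞} (hh : Measurable h) (k : ℕ) :
    ∫⁻ ω in S, h (gridIncrement W τ D k ω) ∂P =
      ∫⁻ ω in S, ∫⁻ z, h (√(gridPoint k (gridIndex k (D ω)) : ℝ) * z) ∂(gaussianReal 0 1) ∂P := by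
  let p : Ω → ℕ × ℕ := fun ω => (gridIndex k (τ ω), gridIndex k (D ω))
  have hp : Measurable[hτ.measurableSpace] p :=
    ((measurable_gridIndex k).comp (measurable_of_isStoppingTime hτ)).prodMk
      ((measurable_gridIndex k).comp hD)
  have hC : ∀ i, MeasurableSet[hτ.measurableSpace] (S ∩ p ⁻¹' {i}) := fun i =>
    hS.inter (hp (measurableSet_singleton i))
  have hC' : ∀ i, MeasurableSet (S ∩ p ⁻¹' {i}) := fun i => hτ.measurableSpace_le _ (hC i)
  have hS' : S = ⋃ i, S ∩ p ⁻¹' {i} := by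
    ext ω
    simp
  have hdisj : Pairwise (Function.onFun Disjoint fun i => S ∩ p ⁻¹' {i}) := by
    intro i j hij
    refine Set.disjoint_left.2 fun ω h1 h2 => hij ?_
    exact h1.2.symm.trans h2.2
  rw [hS', lintegral_iUnion hC' hdisj, lintegral_iUnion hC' hdisj]
  refine tsum_congr fun i => ?_
  have hCq := measurableSet_of_subset_le hτ (hC i) (q := gridPoint k (i.1 + 1)) fun ω hω => by
    have : p ω = i := hω.2
    rw [← this]
    exact (lt_gridPoint_gridIndex_add_one k (τ ω)).le
  have hp1 : ∀ ω ∈ S ∩ p ⁻¹' {i}, gridIndex k (τ ω) = i.1 ∧ gridIndex k (D ω) = i.2 := by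
    intro ω hω
    have : p ω = i := hω.2
    exact ⟨congrArg Prod.fst this, congrArg Prod.snd this⟩
  calc ∫⁻ ω in S ∩ p ⁻¹' {i}, h (gridIncrement W τ D k ω) ∂P
      = ∫⁻ ω in S ∩ p ⁻¹' {i}, h (W (gridPoint k (i.1 + 1) + gridPoint k i.2) ω -
          W (gridPoint k (i.1 + 1)) ω) ∂P := by
        refine setLIntegral_congr_fun (hC' i) fun ω hω => ?_
        simp only [gridIncrement, (hp1 ω hω).1, (hp1 ω hω).2]
    _ = P (S ∩ p ⁻¹' {i}) * ∫⁻ x, h x ∂(gaussianReal 0 (gridPoint k i.2)) := by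
        rw [← lintegral_map (f := h) (g := fun ω =>
            W (gridPoint k (i.1 + 1) + gridPoint k i.2) ω - W (gridPoint k (i.1 + 1)) ω)
          hh ((hWm _).sub (hWm _)), map_restrict_increment hWm hW _ _ hCq, lintegral_smul_measure,
          smul_eq_mul]
    _ = ∫⁻ ω in S ∩ p ⁻¹' {i},
          ∫⁻ z, h (√(gridPoint k i.2 : ℝ) * z) ∂(gaussianReal 0 1) ∂P := by
        rw [gaussianReal_eq_map, lintegral_map hh (by fun_prop), setLIntegral_const, mul_comm]
    _ = _ := by
        refine setLIntegral_congr_fun (hC' i) fun ω hω => ?_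
        simp only [(hp1 ω hω).2]

lemma continuous_lintegral_gaussian (h : ℝ →ᵇ ℝ≥0) :
    Continuous fun d : ℝ≥0 => ∫⁻ z, (h (√(d : ℝ) * z) : ℝ≥0∞) ∂(gaussianReal 0 1) := by
  obtain ⟨c, hc⟩ := h.isBounded_range.bddAbove
  refine continuous_iff_continuousAt.2 fun d => ?_
  refine tendsto_lintegral_filter_of_dominated_convergence (fun _ => (c : ℝ≥0∞)) ?_ ?_ ?_ ?_
  · exact Eventually.of_forall fun d => by fun_prop
  · exact Eventually.of_forall fun d => Eventually.of_forall fun z =>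
      ENNReal.coe_le_coe.2 (hc ⟨_, rfl⟩)
  · simp
  · refine Eventually.of_forall fun z => ?_
    have : Continuous fun d : ℝ≥0 => (h (√(d : ℝ) * z) : ℝ≥0∞) := by fun_prop
    exact this.tendsto d

variable [IsProbabilityMeasure P]

/-- Dominated convergence along the grids: path continuity handles the left side, continuity of the
Gaussian integral in the variance the right. -/
lemma setLIntegral_increment (hW : IsBrownianReal W P)
    (hD : Measurable[hτ.measurableSpace] D) {S : Set Ω} (hS : MeasurableSet[hτ.measurableSpace] S)
    (h : ℝ →ᵇ ℝ≥0) :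
    ∫⁻ ω in S, h (W (τ ω + D ω) ω - W (τ ω) ω) ∂P =
      ∫⁻ ω in S, ∫⁻ z, h (√(D ω : ℝ) * z) ∂(gaussianReal 0 1) ∂P := by
  have hτ' : Measurable τ := (measurable_of_isStoppingTime hτ).mono hτ.measurableSpace_le le_rfl
  have hD' : Measurable D := hD.mono hτ.measurableSpace_le le_rfl
  have hm : Measurable fun x => (h x : ℝ≥0∞) := by fun_prop
  obtain ⟨c, hc⟩ := h.isBounded_range.bddAbove
  have hbd : ∀ x, (h x : ℝ≥0∞) ≤ c := fun x => ENNReal.coe_le_coe.2 (hc ⟨_, rfl⟩)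
  have hcont := continuous_lintegral_gaussian h
  have h1 : Tendsto (fun k => ∫⁻ ω in S, h (gridIncrement W τ D k ω) ∂P) atTop
      (𝓝 (∫⁻ ω in S, h (W (τ ω + D ω) ω - W (τ ω) ω) ∂P)) := by
    refine tendsto_lintegral_of_dominated_convergence (fun _ => (c : ℝ≥0∞)) (fun k => ?_)
      (fun k => Eventually.of_forall fun ω => hbd _) ?_ ?_
    · exact hm.comp (measurable_gridIncrement hWm hτ' hD' k)
    · simp [ENNReal.mul_eq_top]
    · filter_upwards [ae_restrict_of_ae hW.cont] with ω hω
      have : Continuous fun x => (h x : ℝ≥0∞) := by fun_prop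
      exact (this.tendsto _).comp (tendsto_gridIncrement hω)
  have h2 : Tendsto (fun k => ∫⁻ ω in S,
        ∫⁻ z, h (√(gridPoint k (gridIndex k (D ω)) : ℝ) * z) ∂(gaussianReal 0 1) ∂P) atTop
      (𝓝 (∫⁻ ω in S, ∫⁻ z, h (√(D ω : ℝ) * z) ∂(gaussianReal 0 1) ∂P)) := by
    refine tendsto_lintegral_of_dominated_convergence (fun _ => (c : ℝ≥0∞)) (fun k => ?_)
      (fun k => Eventually.of_forall fun ω => ?_) ?_ ?_
    · have hg : Measurable fun ω => gridPoint k (gridIndex k (D ω)) :=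
        (measurable_of_countable (gridPoint k)).comp ((measurable_gridIndex k).comp hD')
      exact hcont.measurable.comp hg
    · calc _ ≤ ∫⁻ _, (c : ℝ≥0∞) ∂(gaussianReal 0 1) := lintegral_mono fun z => hbd _
        _ = c := by simp
    · simp [ENNReal.mul_eq_top]
    · exact Eventually.of_forall fun ω =>
        (hcont.tendsto _).comp (tendsto_gridPoint_gridIndex (D ω))
  refine tendsto_nhds_unique h1 (h2.congr fun k => ?_)
  exact (setLIntegral_gridIncrement hWm hτ hW.toIsPreBrownianReal hD hS hm k).symm

/-- **Strong Markov property** for an increment whose length is known at its starting time: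
jointly with any `ℱ_τ`-measurable random variable, `W (τ + D) - W τ` has the law of `√D Z` with
`Z` a standard Gaussian variable that is independent of `ℱ_τ`. -/
theorem map_prodMk_increment (hW : IsBrownianReal W P) (hD : Measurable[hτ.measurableSpace] D)
    {E : Type*} [MeasurableSpace E] {V : Ω → E} (hV : Measurable[hτ.measurableSpace] V) :
    P.map (fun ω => (V ω, W (τ ω + D ω) ω - W (τ ω) ω)) =
      (P.prod (gaussianReal 0 1)).map (fun p => (V p.1, √(D p.1 : ℝ) * p.2)) := by
  have hτ' : Measurable τ := (measurable_of_isStoppingTime hτ).mono hτ.measurableSpace_le le_rfl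
  have hD' : Measurable D := hD.mono hτ.measurableSpace_le le_rfl
  have hV' : Measurable V := hV.mono hτ.measurableSpace_le le_rfl
  have hY := aemeasurable_increment hWm hW.cont hτ' hD'
  have hZ : Measurable (fun p : Ω × ℝ => √(D p.1 : ℝ) * p.2) := by fun_prop
  have hVZ : Measurable (fun p : Ω × ℝ => (V p.1, √(D p.1 : ℝ) * p.2)) := by fun_prop
  -- On a rectangle `A ×ˢ B`, the condition on `V` is an event of `ℱ_τ`; bounded continuous
  -- functions then identify the law of the increment restricted to it.
  refine Measure.ext_prod fun {A B} hA hB => ?_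
  have hS : MeasurableSet[hτ.measurableSpace] (V ⁻¹' A) := hV hA
  have key : (P.restrict (V ⁻¹' A)).map (fun ω => W (τ ω + D ω) ω - W (τ ω) ω) =
      ((P.restrict (V ⁻¹' A)).prod (gaussianReal 0 1)).map (fun p => √(D p.1 : ℝ) * p.2) := by
    refine ext_of_forall_lintegral_eq_of_IsFiniteMeasure fun h => ?_
    have hm : Measurable fun x => (h x : ℝ≥0∞) := by fun_prop
    rw [lintegral_map' hm.aemeasurable hY.restrict, lintegral_map hm hZ,
      lintegral_prod _ (by fun_prop)]
    exact setLIntegral_increment hWm hτ hW hD hS h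
  have := DFunLike.congr_fun key B
  rw [Measure.map_apply_of_aemeasurable hY.restrict hB, Measure.map_apply hZ hB,
    Measure.restrict_apply₀ (hY.restrict.nullMeasurableSet_preimage hB)] at this
  rw [Measure.map_apply_of_aemeasurable (hV'.aemeasurable.prodMk hY) (hA.prod hB),
    Measure.map_apply hVZ (hA.prod hB), Set.mk_preimage_prod, Set.inter_comm, this,
    ← Measure.restrict_univ (μ := gaussianReal 0 1), Measure.prod_restrict,
    Measure.restrict_apply (hZ hB)]
  rw [Measure.restrict_univ]
  congr 1
  ext p
  simp [and_comm]

end StrongMarkov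

/-! ### One step with frozen data -/

section Step

/-- One step of the splitting scheme, as a function of the current value, the step size and the
increment of the driving path. -/
noncomputable def schemeStep (κ θ σ : ℝ) (x d w : ℝ) : ℝ :=
  Real.exp (-κ * d) *
    (x + 2 * alpha κ θ σ * d + σ * √(x + 2 * alpha κ θ σ * d) * w + σ ^ 2 * w ^ 2 / 4)

variable {κ θ σ : ℝ}

lemma continuous_schemeStep :
    Continuous fun p : ℝ × ℝ × ℝ => schemeStep κ θ σ p.1 p.2.1 p.2.2 := by
  unfold schemeStep
  fun_prop

/-- With `a = x + 2αd`, the bracket equals `(√a + σw/2)²`. -/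
lemma schemeStep_nonneg {x d : ℝ} (h : 0 ≤ x + 2 * alpha κ θ σ * d) (w : ℝ) :
    0 ≤ schemeStep κ θ σ x d w := by
  refine mul_nonneg (Real.exp_nonneg _) ?_
  have h1 := Real.sq_sqrt h
  nlinarith [sq_nonneg (√(x + 2 * alpha κ θ σ * d) + σ * w / 2)]

lemma integral_sq_gaussianReal_one : ∫ z, z ^ 2 ∂(gaussianReal 0 1) = 1 := by
  have h := variance_id_gaussianReal (μ := 0) (v := 1)
  rw [variance_of_integral_eq_zero aemeasurable_id (by simp)] at h
  simpa using h

lemma lintegral_schemeStep_gaussian (hκ : 0 < κ) (hθ : 0 < θ) {x d : ℝ} (hx : 0 ≤ x) (hd : 0 ≤ d)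
    (h : 0 ≤ x + 2 * alpha κ θ σ * d) :
    ∫⁻ z, ENNReal.ofReal (schemeStep κ θ σ x d (√d * z)) ∂(gaussianReal 0 1) ≤
      ENNReal.ofReal x + ENNReal.ofReal (κ * θ) * ENNReal.ofReal d := by
  have hi1 : Integrable (fun z : ℝ => z) (gaussianReal 0 1) :=
    (memLp_id_gaussianReal (μ := 0) (v := 1) 1).integrable le_rfl
  have hi2 : Integrable (fun z : ℝ => z ^ 2) (gaussianReal 0 1) :=
    (memLp_id_gaussianReal (μ := 0) (v := 1) 2).integrable_sq
  set a := x + 2 * alpha κ θ σ * d with ha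
  have hform : ∀ z, schemeStep κ θ σ x d (√d * z) =
      Real.exp (-κ * d) * a + Real.exp (-κ * d) * (σ * √a * √d) * z
        + Real.exp (-κ * d) * (σ ^ 2 * d / 4) * z ^ 2 := by
    intro z
    rw [schemeStep, ← ha, mul_pow, Real.sq_sqrt hd]
    ring
  have hia : Integrable (fun z : ℝ => Real.exp (-κ * d) * a
      + Real.exp (-κ * d) * (σ * √a * √d) * z) (gaussianReal 0 1) :=
    (integrable_const _).add (hi1.const_mul _)
  have hib : Integrable (fun z : ℝ => Real.exp (-κ * d) * (σ ^ 2 * d / 4) * z ^ 2)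
      (gaussianReal 0 1) := hi2.const_mul _
  have hint : Integrable (fun z => schemeStep κ θ σ x d (√d * z)) (gaussianReal 0 1) := by
    simp_rw [hform]
    exact hia.add hib
  rw [← ofReal_integral_eq_lintegral_ofReal hint
    (Eventually.of_forall fun z => schemeStep_nonneg h _), ← ENNReal.ofReal_mul (by positivity),
    ← ENNReal.ofReal_add hx (by positivity)]
  refine ENNReal.ofReal_le_ofReal ?_
  simp_rw [hform]
  rw [integral_add hia hib, integral_add (integrable_const _) (hi1.const_mul _),
    integral_const, integral_const_mul, integral_const_mul, integral_sq_gaussianReal_one]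
  have h0 : ∫ z, z ∂(gaussianReal 0 1) = 0 := integral_id_gaussianReal
  have hexp : Real.exp (-κ * d) ≤ 1 := Real.exp_le_one_iff.2 (by nlinarith)
  have hmean : a + σ ^ 2 * d / 4 = x + κ * θ * d := by
    rw [ha, alpha]
    ring
  have hpos : 0 ≤ x + κ * θ * d := by positivity
  rw [h0, probReal_univ, one_smul, mul_zero, add_zero, mul_one, ← mul_add, hmean]
  exact mul_le_of_le_one_left hpos hexp

end Step

/-! ### Pathwise properties of the step index and the stopped scheme -/

section Path

variable {Ω : Type*} {W : ℝ≥0 → Ω → ℝ} {t : ℕ → Ω → ℝ≥0} {κ θ σ X₀ : ℝ}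

/-- Finiteness is essential: in `ℕ` the supremum of an unbounded set is `0`. -/
lemma lt_stepIndex {s : ℝ≥0} {ω : Ω} (hfin : (stepSet t s ω).Finite) {n : ℕ} (h : t n ω < s) :
    n < stepIndex t s ω :=
  le_csSup hfin.bddAbove (show n + 1 ∈ stepSet t s ω from ⟨by omega, h⟩)

lemma node_lt_of_stepIndex_eq_succ {s : ℝ≥0} {ω : Ω} (hfin : (stepSet t s ω).Finite) {m : ℕ}
    (h : stepIndex t s ω = m + 1) : t m ω < s := by
  have hne : (stepSet t s ω).Nonempty := by
    by_contra hne
    rw [Set.not_nonempty_iff_eq_empty] at hne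
    simp [stepIndex, hne] at h
  have hmem : m + 1 ∈ stepSet t s ω := by
    rw [← h]
    exact Nat.sSup_mem hne hfin.bddAbove
  exact hmem.2

lemma scheme_succ (n : ℕ) (ω : Ω) :
    scheme κ θ σ X₀ W t (n + 1) ω =
      schemeStep κ θ σ (scheme κ θ σ X₀ W t n ω) (dt t n ω) (dW W t n ω) := rfl

/-- The scheme, stopped at the right endpoint of the step that contains `s`. -/
noncomputable def stoppedScheme (κ θ σ X₀ : ℝ) (W : ℝ≥0 → Ω → ℝ) (t : ℕ → Ω → ℝ≥0) (s : ℝ≥0) :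
    ℕ → Ω → ℝ
  | 0, _ => X₀
  | n + 1, ω =>
    if t n ω < s then scheme κ θ σ X₀ W t (n + 1) ω else stoppedScheme κ θ σ X₀ W t s n ω

lemma stoppedScheme_eq_scheme {s : ℝ≥0} {ω : Ω} (hle : ∀ n, t n ω ≤ t (n + 1) ω) {n : ℕ}
    (h : t n ω < s) : stoppedScheme κ θ σ X₀ W t s n ω = scheme κ θ σ X₀ W t n ω := by
  cases n with
  | zero => rfl
  | succ n => exact if_pos ((hle n).trans_lt h)

/-- From index `N^{(s)}` on, no node lies before `s`, so the recursion is frozen. -/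
lemma stoppedScheme_eq_of_stepIndex_le {s : ℝ≥0} {ω : Ω} (hfin : (stepSet t s ω).Finite) {n : ℕ}
    (h : stepIndex t s ω ≤ n) : stoppedScheme κ θ σ X₀ W t s n ω =
      scheme κ θ σ X₀ W t (stepIndex t s ω) ω := by
  induction n, h using Nat.le_induction with
  | base =>
    cases hN : stepIndex t s ω with
    | zero => rfl
    | succ m => exact if_pos (node_lt_of_stepIndex_eq_succ hfin hN)
  | succ n hn ih =>
    rw [← ih]
    exact if_neg fun h => absurd (lt_stepIndex hfin h) (not_lt.2 hn)

end Path

/-! ### Consequences of admissibility of the mesh -/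

section Mesh

variable {Ω : Type*} [MeasurableSpace Ω] {P : Measure Ω} {W : ℝ≥0 → Ω → ℝ}
  {hWm : ∀ s, Measurable (W s)} {T dtMax : ℝ≥0} {t : ℕ → Ω → ℝ≥0}

/-- The step `Δt_{n+1}` as a nonnegative real number. -/
def stepLength (t : ℕ → Ω → ℝ≥0) (n : ℕ) (ω : Ω) : ℝ≥0 := t (n + 1) ω - t n ω

namespace IsAdmissibleMesh

lemma measurable_stepLength (ht : IsAdmissibleMesh P W hWm T dtMax t) (n : ℕ) :
    Measurable[(ht.isStoppingTime n).measurableSpace] (stepLength t n) := by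
  have : stepLength t n = fun ω => Real.toNNReal (dt t n ω) := by
    ext ω
    simp [stepLength, dt, NNReal.sub_def]
  rw [this]
  exact measurable_real_toNNReal.comp (ht.measurable_dt n)

lemma measurable_node (ht : IsAdmissibleMesh P W hWm T dtMax t) (n : ℕ) : Measurable (t n) :=
  (measurable_of_isStoppingTime (ht.isStoppingTime n)).mono
    (ht.isStoppingTime n).measurableSpace_le le_rfl

lemma ae_le_succ (ht : IsAdmissibleMesh P W hWm T dtMax t) :
    ∀ᵐ ω ∂P, ∀ n, t n ω ≤ t (n + 1) ω := by
  filter_upwards [ht.le_end, ht.lt_succ, ht.eq_end] with ω h1 h2 h3 n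
  rcases (h1 n).lt_or_eq with h | h
  · exact (h2 n h).le
  · rw [h, h3 n h]

lemma ae_stepSet_finite (ht : IsAdmissibleMesh P W hWm T dtMax t) :
    ∀ᵐ ω ∂P, ∀ s ≤ T, (stepSet t s ω).Finite := by
  filter_upwards [ht.finite] with ω h s hs
  exact h.subset fun n hn => ⟨hn.1, hn.2.trans_le hs⟩

end IsAdmissibleMesh

end Mesh

/-! ### Nonnegativity, measurability and mean growth of the scheme -/

section Scheme

variable {Ω : Type*} [MeasurableSpace Ω] {P : Measure Ω}
  {W : ℝ≥0 → Ω → ℝ} {hWm : ∀ s, Measurable (W s)} {T dtMax : ℝ≥0} {t : ℕ → Ω → ℝ≥0}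
  {κ θ σ X₀ : ℝ}

/-- For `α ≥ 0` a nonnegative value makes the radicand nonnegative; for `α < 0` this is `hreal`. A
nonnegative radicand makes the next value a square, which closes the induction. -/
lemma ae_scheme_nonneg (hX₀ : 0 < X₀) (ht : IsAdmissibleMesh P W hWm T dtMax t)
    (hreal : alpha κ θ σ < 0 → ∀ᵐ ω ∂P, ∀ n, n < stepIndex t T ω →
      0 ≤ scheme κ θ σ X₀ W t n ω + 2 * alpha κ θ σ * dt t n ω) :
    ∀ᵐ ω ∂P, ∀ n, t n ω < T → 0 ≤ scheme κ θ σ X₀ W t n ω ∧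
      0 ≤ scheme κ θ σ X₀ W t n ω + 2 * alpha κ θ σ * dt t n ω ∧
      0 ≤ scheme κ θ σ X₀ W t (n + 1) ω := by
  have hroot : ∀ᵐ ω ∂P, ∀ n, t n ω < T → 0 ≤ scheme κ θ σ X₀ W t n ω →
      0 ≤ scheme κ θ σ X₀ W t n ω + 2 * alpha κ θ σ * dt t n ω := by
    rcases lt_or_ge (alpha κ θ σ) 0 with hα | hα
    · filter_upwards [hreal hα, ht.finite] with ω h hfin n hn _
      exact h n (lt_stepIndex hfin hn)
    · filter_upwards [ht.ae_le_succ] with ω h n _ hX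
      have hdt : 0 ≤ dt t n ω := sub_nonneg.2 (NNReal.coe_le_coe.2 (h n))
      positivity
  filter_upwards [hroot, ht.ae_le_succ] with ω hr hle n
  induction n with
  | zero =>
    intro hn
    have h0 : 0 ≤ scheme κ θ σ X₀ W t 0 ω := hX₀.le
    exact ⟨h0, hr 0 hn h0, schemeStep_nonneg (hr 0 hn h0) _⟩
  | succ n ih =>
    intro hn
    have h0 := (ih ((hle n).trans_lt hn)).2.2
    exact ⟨h0, hr _ hn h0, schemeStep_nonneg (hr _ hn h0) _⟩

lemma aestronglyMeasurable_scheme (hW : IsBrownianReal W P)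
    (ht : IsAdmissibleMesh P W hWm T dtMax t) (n : ℕ) :
    AEStronglyMeasurable[(ht.isStoppingTime n).measurableSpace] (scheme κ θ σ X₀ W t n) P := by
  have hWt : ∀ n, AEStronglyMeasurable[(ht.isStoppingTime n).measurableSpace]
      (fun ω => W (t n ω) ω) P := fun n =>
    aestronglyMeasurable_eval_stoppingTime (ht.isStoppingTime n)
      (fun i => (Filtration.stronglyAdapted_natural
        (fun s => (hWm s).stronglyMeasurable) i).measurable) hW.cont
  induction n with
  | zero => exact stronglyMeasurable_const.aestronglyMeasurable
  | succ n ih =>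
    have hle : ∀ᵐ ω ∂P, t n ω ≤ t (n + 1) ω := by
      filter_upwards [ht.ae_le_succ] with ω h using h n
    have hmono {f : Ω → ℝ}
        (hf : AEStronglyMeasurable[(ht.isStoppingTime n).measurableSpace] f P) :
        AEStronglyMeasurable[(ht.isStoppingTime (n + 1)).measurableSpace] f P :=
      aestronglyMeasurable_mono_stoppingTime (ht.isStoppingTime n) (ht.isStoppingTime (n + 1))
        hle hf
    exact continuous_schemeStep.comp_aestronglyMeasurable ((hmono ih).prodMk
      ((hmono (ht.measurable_dt n).stronglyMeasurable.aestronglyMeasurable).prodMk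
        ((hWt (n + 1)).sub (hmono (hWt n)))))

lemma aemeasurable_stoppedScheme (hW : IsBrownianReal W P)
    (ht : IsAdmissibleMesh P W hWm T dtMax t) (s : ℝ≥0) (n : ℕ) :
    AEMeasurable (stoppedScheme κ θ σ X₀ W t s n) P := by
  induction n with
  | zero => exact measurable_const.aemeasurable
  | succ n ih =>
    have hX := ((aestronglyMeasurable_scheme (κ := κ) (θ := θ) (σ := σ) (X₀ := X₀) hW ht
      (n + 1)).mono (ht.isStoppingTime (n + 1)).measurableSpace_le).aemeasurable
    exact ⟨fun ω => if t n ω < s then hX.mk _ ω else ih.mk _ ω,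
      Measurable.ite (measurableSet_lt (ht.measurable_node n) measurable_const) hX.measurable_mk
        ih.measurable_mk, by
      filter_upwards [hX.ae_eq_mk, ih.ae_eq_mk] with ω h1 h2
      simp only [stoppedScheme, h1, h2]⟩

variable [IsProbabilityMeasure P]

/-- The mean of the scheme grows by at most `κ θ` times the mean step size. -/
lemma setLIntegral_scheme_succ_le (hW : IsBrownianReal W P) (hκ : 0 < κ) (hθ : 0 < θ)
    (hX₀ : 0 < X₀) (ht : IsAdmissibleMesh P W hWm T dtMax t)
    (hreal : alpha κ θ σ < 0 → ∀ᵐ ω ∂P, ∀ n, n < stepIndex t T ω →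
      0 ≤ scheme κ θ σ X₀ W t n ω + 2 * alpha κ θ σ * dt t n ω)
    {s : ℝ≥0} (hs : s ≤ T) (n : ℕ) :
    ∫⁻ ω in {ω | t n ω < s}, ENNReal.ofReal (scheme κ θ σ X₀ W t (n + 1) ω) ∂P ≤
      ∫⁻ ω in {ω | t n ω < s}, (ENNReal.ofReal (scheme κ θ σ X₀ W t n ω) +
        ENNReal.ofReal (κ * θ) * stepLength t n ω) ∂P := by
  obtain ⟨X, hX, hXeq⟩ := aestronglyMeasurable_scheme (κ := κ) (θ := θ) (σ := σ) (X₀ := X₀) hW ht n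
  have hτ := ht.isStoppingTime n
  have hle := hτ.measurableSpace_le
  set A : Set Ω := {ω | t n ω < s} with hA_def
  have hA : MeasurableSet[hτ.measurableSpace] A := measurable_of_isStoppingTime hτ measurableSet_Iio
  have hD := ht.measurable_stepLength n
  -- The indicator of `A` joins the `ℱ_{t_n}`-measurable data `V`, so the integral over `A` is a
  -- functional of the joint law of `V` and the increment.
  let c : Ω → ℝ≥0∞ := A.indicator fun _ => 1
  have hc : Measurable[hτ.measurableSpace] c := measurable_const.indicator hA
  let V : Ω → ℝ × ℝ≥0 × ℝ≥0∞ := fun ω => (X ω, stepLength t n ω, c ω)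
  have hV : Measurable[hτ.measurableSpace] V :=
    hX.measurable.prodMk (hD.prodMk hc)
  have hV' : Measurable V := hV.mono hle le_rfl
  have hD' : Measurable (stepLength t n) := hD.mono hle le_rfl
  let G : (ℝ × ℝ≥0 × ℝ≥0∞) × ℝ → ℝ≥0∞ := fun p =>
    p.1.2.2 * ENNReal.ofReal (schemeStep κ θ σ p.1.1 p.1.2.1 p.2)
  have hG : Measurable G := by
    have h1 : Measurable fun p : (ℝ × ℝ≥0 × ℝ≥0∞) × ℝ =>
        schemeStep κ θ σ p.1.1 p.1.2.1 p.2 :=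
      continuous_schemeStep.measurable.comp
        (g := fun p : ℝ × ℝ × ℝ => schemeStep κ θ σ p.1 p.2.1 p.2.2)
        (f := fun p : (ℝ × ℝ≥0 × ℝ≥0∞) × ℝ => (p.1.1, (p.1.2.1 : ℝ), p.2)) (by fun_prop)
    exact (by fun_prop : Measurable fun p : (ℝ × ℝ≥0 × ℝ≥0∞) × ℝ => p.1.2.2).mul h1.ennreal_ofReal
  have hVZ : Measurable fun p : Ω × ℝ => (V p.1, √(stepLength t n p.1 : ℝ) * p.2) := by fun_prop
  have hY := aemeasurable_increment hWm hW.cont (ht.measurable_node n) hD'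
  have hdt : ∀ᵐ ω ∂P, dt t n ω = stepLength t n ω ∧
      dW W t n ω = W (t n ω + stepLength t n ω) ω - W (t n ω) ω := by
    filter_upwards [ht.ae_le_succ] with ω h
    refine ⟨(NNReal.coe_sub (h n)).symm, ?_⟩
    rw [dW, stepLength, add_tsub_cancel_of_le (h n)]
  rw [← lintegral_indicator (hle _ hA), ← lintegral_indicator (hle _ hA)]
  calc ∫⁻ ω, A.indicator (fun ω => ENNReal.ofReal (scheme κ θ σ X₀ W t (n + 1) ω)) ω ∂P
      = ∫⁻ ω, G (V ω, W (t n ω + stepLength t n ω) ω - W (t n ω) ω) ∂P := by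
        refine lintegral_congr_ae ?_
        filter_upwards [hdt, hXeq] with ω h1 h2
        by_cases hω : ω ∈ A
        · simp [G, V, c, hω, scheme_succ, h1.1, h1.2, h2]
        · simp [G, V, c, hω]
    _ = ∫⁻ p, G (V p.1, √(stepLength t n p.1 : ℝ) * p.2) ∂(P.prod (gaussianReal 0 1)) := by
        rw [← lintegral_map' (f := G) hG.aemeasurable (hV'.aemeasurable.prodMk hY),
          map_prodMk_increment hWm hτ hW hD hV, lintegral_map hG hVZ]
    _ = ∫⁻ ω, ∫⁻ z, G (V ω, √(stepLength t n ω : ℝ) * z) ∂(gaussianReal 0 1) ∂P :=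
        lintegral_prod _ (hG.comp hVZ).aemeasurable
    _ ≤ _ := by
        refine lintegral_mono_ae ?_
        filter_upwards [hdt, hXeq, ae_scheme_nonneg hX₀ ht hreal] with ω h1 h2 h3
        by_cases hω : ω ∈ A
        · obtain ⟨hx, ha, -⟩ := h3 n (lt_of_lt_of_le hω hs)
          rw [h1.1, h2] at ha
          rw [h2] at hx
          have := lintegral_schemeStep_gaussian hκ hθ hx (stepLength t n ω).coe_nonneg ha
          simpa [G, V, c, hω, h2] using this
        · simp [G, V, c, hω]

lemma lintegral_stoppedScheme_le (hW : IsBrownianReal W P) (hκ : 0 < κ) (hθ : 0 < θ)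
    (hX₀ : 0 < X₀) (ht : IsAdmissibleMesh P W hWm T dtMax t)
    (hreal : alpha κ θ σ < 0 → ∀ᵐ ω ∂P, ∀ n, n < stepIndex t T ω →
      0 ≤ scheme κ θ σ X₀ W t n ω + 2 * alpha κ θ σ * dt t n ω)
    {s : ℝ≥0} (hs : s ≤ T) (n : ℕ) :
    ∫⁻ ω, ENNReal.ofReal (stoppedScheme κ θ σ X₀ W t s n ω) ∂P ≤
      ENNReal.ofReal X₀ + ENNReal.ofReal (κ * θ) * ∫⁻ ω, t n ω ∂P := by
  induction n with
  | zero => simp [stoppedScheme]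
  | succ n ih =>
    have hA : MeasurableSet {ω | t n ω < s} := measurableSet_lt (ht.measurable_node n)
      measurable_const
    have hDm : Measurable fun ω => (stepLength t n ω : ℝ≥0∞) :=
      ((ht.measurable_stepLength n).mono (ht.isStoppingTime n).measurableSpace_le
        le_rfl).coe_nnreal_ennreal
    have hDc := hDm.const_mul (ENNReal.ofReal (κ * θ))
    have htm : Measurable fun ω => (t n ω : ℝ≥0∞) := (ht.measurable_node n).coe_nnreal_ennreal
    have hnode : ∫⁻ ω, (t (n + 1) ω : ℝ≥0∞) ∂P =
        ∫⁻ ω, (t n ω : ℝ≥0∞) ∂P + ∫⁻ ω, (stepLength t n ω : ℝ≥0∞) ∂P := by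
      rw [← lintegral_add_left htm]
      refine lintegral_congr_ae ?_
      filter_upwards [ht.ae_le_succ] with ω h
      rw [← ENNReal.coe_add, stepLength, add_tsub_cancel_of_le (h n)]
    calc ∫⁻ ω, ENNReal.ofReal (stoppedScheme κ θ σ X₀ W t s (n + 1) ω) ∂P
        = ∫⁻ ω in {ω | t n ω < s}, ENNReal.ofReal (scheme κ θ σ X₀ W t (n + 1) ω) ∂P +
          ∫⁻ ω in {ω | t n ω < s}ᶜ, ENNReal.ofReal (stoppedScheme κ θ σ X₀ W t s n ω) ∂P := by
          rw [← lintegral_add_compl _ hA]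
          congr 1
          · refine setLIntegral_congr_fun hA fun ω hω => ?_
            exact congrArg ENNReal.ofReal (if_pos hω)
          · refine setLIntegral_congr_fun hA.compl fun ω hω => ?_
            exact congrArg ENNReal.ofReal (if_neg hω)
      _ ≤ (∫⁻ ω in {ω | t n ω < s}, ENNReal.ofReal (stoppedScheme κ θ σ X₀ W t s n ω) ∂P +
            ∫⁻ ω, ENNReal.ofReal (κ * θ) * stepLength t n ω ∂P) +
          ∫⁻ ω in {ω | t n ω < s}ᶜ, ENNReal.ofReal (stoppedScheme κ θ σ X₀ W t s n ω) ∂P := by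
          refine add_le_add_left ?_ _
          -- The step length is then integrated over all of `Ω`, not only where the scheme still
          -- moves; this costs nothing since the total stays below `T`, and it makes the sum
          -- telescope.
          refine (setLIntegral_scheme_succ_le hW hκ hθ hX₀ ht hreal hs n).trans ?_
          rw [lintegral_add_right _ hDc]
          refine add_le_add (le_of_eq ?_) (setLIntegral_le_lintegral _ _)
          refine lintegral_congr_ae ?_
          filter_upwards [ae_restrict_mem hA, ae_restrict_of_ae ht.ae_le_succ] with ω hω hle
          rw [stoppedScheme_eq_scheme hle hω]
      _ = ∫⁻ ω, ENNReal.ofReal (stoppedScheme κ θ σ X₀ W t s n ω) ∂P +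
            ENNReal.ofReal (κ * θ) * ∫⁻ ω, stepLength t n ω ∂P := by
          rw [add_right_comm, lintegral_add_compl _ hA, lintegral_const_mul _ hDm]
      _ ≤ _ := by
          rw [hnode, mul_add, ← add_assoc]
          exact add_le_add_left ih _

end Scheme

end CIRSplitting

/-! ### Passage to the limit -/

theorem mainTheorem1 {Ω : Type*} [MeasurableSpace Ω] (P : Measure Ω) [IsProbabilityMeasure P]
    (W : ℝ≥0 → Ω → ℝ) (hWm : ∀ s, Measurable (W s)) (hW : IsBrownianReal W P)
    (κ θ σ X₀ : ℝ) (hκ : 0 < κ) (hθ : 0 < θ) (hσ : 0 < σ) (hX₀ : 0 < X₀)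
    (T dtMax : ℝ≥0) (t : ℕ → Ω → ℝ≥0)
    (ht : CIRSplitting.IsAdmissibleMesh P W hWm T dtMax t)
    -- for negative `α` the square root in the scheme has to be real; otherwise it always is
    (hreal : CIRSplitting.alpha κ θ σ < 0 →
      ∀ᵐ ω ∂P, ∀ n, n < CIRSplitting.stepIndex t T ω →
        0 ≤ CIRSplitting.scheme κ θ σ X₀ W t n ω
          + 2 * CIRSplitting.alpha κ θ σ * CIRSplitting.dt t n ω)
    (s : ℝ≥0) (hs : s ≤ T) :
    Integrable (fun ω => CIRSplitting.scheme κ θ σ X₀ W t (CIRSplitting.stepIndex t s ω) ω) P ∧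
    ∫ ω, CIRSplitting.scheme κ θ σ X₀ W t (CIRSplitting.stepIndex t s ω) ω ∂P
      ≤ X₀ + κ * θ * T := by
  set Z : Ω → ℝ := fun ω => CIRSplitting.scheme κ θ σ X₀ W t (CIRSplitting.stepIndex t s ω) ω
    with hZ
  have hYm := CIRSplitting.aemeasurable_stoppedScheme (κ := κ) (θ := θ) (σ := σ) (X₀ := X₀) hW ht s
  have hlim : ∀ᵐ ω ∂P, Tendsto (fun n => CIRSplitting.stoppedScheme κ θ σ X₀ W t s n ω) atTop
      (𝓝 (Z ω)) := by
    filter_upwards [ht.ae_stepSet_finite] with ω hfin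
    refine tendsto_const_nhds.congr' ?_
    filter_upwards [eventually_ge_atTop (CIRSplitting.stepIndex t s ω)] with n hn
    exact (CIRSplitting.stoppedScheme_eq_of_stepIndex_le (hfin s hs) hn).symm
  have hZm : AEMeasurable Z P := aemeasurable_of_tendsto_metrizable_ae atTop hYm hlim
  have hZ0 : 0 ≤ᵐ[P] Z := by
    filter_upwards [CIRSplitting.ae_scheme_nonneg hX₀ ht hreal, ht.ae_stepSet_finite]
      with ω hnn hfin
    cases hN : CIRSplitting.stepIndex t s ω with
    | zero =>
      simp only [hZ, hN]
      exact hX₀.le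
    | succ m =>
      simp only [hZ, hN]
      exact (hnn m ((CIRSplitting.node_lt_of_stepIndex_eq_succ (hfin s hs) hN).trans_le hs)).2.2
  have hbound : ∫⁻ ω, ENNReal.ofReal (Z ω) ∂P ≤ ENNReal.ofReal (X₀ + κ * θ * T) := by
    calc ∫⁻ ω, ENNReal.ofReal (Z ω) ∂P
        = ∫⁻ ω, liminf (fun n => ENNReal.ofReal
            (CIRSplitting.stoppedScheme κ θ σ X₀ W t s n ω)) atTop ∂P := by
          refine lintegral_congr_ae ?_
          filter_upwards [hlim] with ω hω
          exact ((ENNReal.continuous_ofReal.tendsto _).comp hω).liminf_eq.symm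
      _ ≤ liminf (fun n => ∫⁻ ω, ENNReal.ofReal
            (CIRSplitting.stoppedScheme κ θ σ X₀ W t s n ω) ∂P) atTop :=
          -- Fatou's lemma needs no domination, and its finite bound also yields integrability.
          lintegral_liminf_le' fun n => (hYm n).ennreal_ofReal
      _ ≤ liminf (fun _ : ℕ => ENNReal.ofReal (X₀ + κ * θ * T)) atTop := by
          refine liminf_le_liminf (Eventually.of_forall fun n => ?_)
          refine (CIRSplitting.lintegral_stoppedScheme_le hW hκ hθ hX₀ ht hreal hs n).trans ?_
          have hT : ∫⁻ ω, (t n ω : ℝ≥0∞) ∂P ≤ T := by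
            calc ∫⁻ ω, (t n ω : ℝ≥0∞) ∂P ≤ ∫⁻ _, (T : ℝ≥0∞) ∂P := by
                  refine lintegral_mono_ae ?_
                  filter_upwards [ht.le_end] with ω h using ENNReal.coe_le_coe.2 (h n)
              _ = T := by simp
          rw [ENNReal.ofReal_add hX₀.le (by positivity),
            ENNReal.ofReal_mul (p := κ * θ) (by positivity), ENNReal.ofReal_coe_nnreal]
          gcongr
      _ = _ := liminf_const _
  have hint : Integrable Z P :=
    (lintegral_ofReal_ne_top_iff_integrable hZm.aestronglyMeasurable hZ0).1
      (ne_top_of_le_ne_top ENNReal.ofReal_ne_top hbound)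
  refine ⟨hint, ?_⟩
  rw [integral_eq_lintegral_of_nonneg_ae hZ0 hZm.aestronglyMeasurable]
  exact ENNReal.toReal_le_of_le_ofReal (by positivity) hbound
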